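/- Let $L$ be the first-order language without equality that has variables $x_0,x_1,\dots$, countably infinitely many function symbols of each arity $n\ge 0$ (those of arity $0$ being the constants), countably infinitely many predicate symbols of each arity $n\ge 0$, the predicate constant $\bot$, the connectives $\land,\lor,\to$ and the quantifiers $\forall,\exists$. Let $V\subseteq[0,1]$ be closed in $\mathbb R$ with $0,1\in V$. An interpretation $\mathfrak I$ based on $V$ consists of a nonempty domain $D$, a function $D^n\to D$ for each $n$-ary function symbol, a function $D^n\to V$ for each $n$-ary predicate symbol, and an element of $D$ for each variable. Terms are evaluated as usual, atomic formulas receive the corresponding values in $V$, and - $\mathfrak I(\bot)=0$, $\mathfrak I(A\land B)=\min(\mathfrak I(A),\mathfrak I(B))$, $\mathfrak I(A\lor B)=\max(\mathfrak I(A),\mathfrak I(B))$, - $\mathfrak I(A\to B)=\mathfrak I(B)$ if $\mathfrak I(A)>\mathfrak I(B)$, and $\mathfrak I(A\to B)=1$ otherwise, - $\mathfrak I(\forall x\,A(x))=\inf_{d\in D}\mathfrak I(A(d))$ and $\mathfrak I(\exists x\,A(x))=\sup_{d\in D}\mathfrak I(A(d))$. The Gödel logic $\mathbf G_V$ is the set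 of all formulas $A$ of $L$ with $\mathfrak I(A)=1$ for every interpretation $\mathfrak I$ based on $V$. A formula is prenex if it has the form $\mathsf Q_1y_1\dots\mathsf Q_ny_n\,B$ with $n\ge 0$, each $\mathsf Q_i\in\{\forall,\exists\}$ and $B$ quantifier-free. **Theorem.** If $V$ is countably infinite, then the prenex fragment of $\mathbf G_V$, i.e. the set of all prenex formulas that belong to $\mathbf G_V$, is not axiomatizable: the set of (Gödel numbers of) its elements is not recursively enumerable. -/

import Mathlib

universe u

namespace GoedelLogic

/-- Terms of the standard first-order language: the variables are indexed by `ℕ`, and for every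
arity `n` there are countably many function symbols, indexed by `ℕ`
(the constants are the function symbols of arity `0`). -/
inductive Term : Type
  | var (x : ℕ) : Term
  | func (n f : ℕ) (ts : Fin n → Term) : Term

/-- First-order formulas over the predicate constant `⊥` and countably many predicate symbols of
every arity, with the connectives `∧`, `∨`, `→` and the quantifiers `∀`, `∃`. -/
inductive Formula : Type
  | falsum : Formula
  | pred (n p : ℕ) (ts : Fin n → Term) : Formula
  | conj (A B : Formula) : Formula
  | disj (A B : Formula) : Formula
  | impl (A B : Formula) : Formula
  | all (x : ℕ) (A : Formula) : Formula
  | ex (x : ℕ) (A : Formula) : Formula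

/-- Formulas without quantifiers. -/
inductive Formula.IsQuantifierFree : Formula → Prop
  | falsum : IsQuantifierFree .falsum
  | pred (n p : ℕ) (ts : Fin n → Term) : IsQuantifierFree (.pred n p ts)
  | conj {A B : Formula} : IsQuantifierFree A → IsQuantifierFree B → IsQuantifierFree (.conj A B)
  | disj {A B : Formula} : IsQuantifierFree A → IsQuantifierFree B → IsQuantifierFree (.disj A B)
  | impl {A B : Formula} : IsQuantifierFree A → IsQuantifierFree B → IsQuantifierFree (.impl A B)

/-- Prenex formulas: a (possibly empty) string of quantifiers followed by a quantifier-free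
formula. -/
inductive Formula.IsPrenex : Formula → Prop
  | quantifierFree {A : Formula} : A.IsQuantifierFree → IsPrenex A
  | all (x : ℕ) {A : Formula} : IsPrenex A → IsPrenex (.all x A)
  | ex (x : ℕ) {A : Formula} : IsPrenex A → IsPrenex (.ex x A)

/-- Truth value sets: closed subsets of `[0, 1]` containing `0` and `1`. -/
structure IsTruthValueSet (V : Set ℝ) : Prop where
  subset_Icc : V ⊆ Set.Icc 0 1
  zero_mem : 0 ∈ V
  one_mem : 1 ∈ V
  isClosed : IsClosed V

/-- A many-valued interpretation based on `V`. The values of the variables are given separately,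
by an assignment `ℕ → D`. -/
structure Interpretation (V : Set ℝ) : Type (u + 1) where
  /-- the domain -/
  D : Type u
  nonempty : Nonempty D
  /-- the interpretation of the `f`-th function symbol of arity `n` -/
  func (n f : ℕ) : (Fin n → D) → D
  /-- the interpretation of the `p`-th predicate symbol of arity `n` -/
  pred (n p : ℕ) : (Fin n → D) → V

namespace Interpretation

variable {V : Set ℝ}

/-- The value of a term. -/
def termValue (I : Interpretation.{u} V) (s : ℕ → I.D) : Term → I.D
  | .var x => s x
  | .func n f ts => I.func n f (fun i => I.termValue s (ts i))

/-- The truth value of a formula. The infimum and supremum are those of the distribution of the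
formula over the domain. -/
noncomputable def value (I : Interpretation.{u} V) : Formula → (ℕ → I.D) → ℝ
  | .falsum, _ => 0
  | .pred n p ts, s => (I.pred n p (fun i => I.termValue s (ts i)) : ℝ)
  | .conj A B, s => min (I.value A s) (I.value B s)
  | .disj A B, s => max (I.value A s) (I.value B s)
  | .impl A B, s => if I.value A s > I.value B s then I.value B s else 1
  | .all x A, s => sInf (Set.range fun d : I.D => I.value A (Function.update s x d))
  | .ex x A, s => sSup (Set.range fun d : I.D => I.value A (Function.update s x d))

/-- Every formula takes a value in `V`; in particular all distributions are nonempty and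
bounded. -/
theorem value_mem (hV : IsTruthValueSet V) (I : Interpretation.{u} V) (A : Formula) :
    ∀ s : ℕ → I.D, I.value A s ∈ V := by
  have := I.nonempty
  induction A with
  | falsum => intro s; exact hV.zero_mem
  | pred n p ts => intro s; exact (I.pred n p _).2
  | conj A B hA hB =>
    intro s; simp only [value]
    rcases min_choice (I.value A s) (I.value B s) with h | h <;> rw [h]
    exacts [hA s, hB s]
  | disj A B hA hB =>
    intro s; simp only [value]
    rcases max_choice (I.value A s) (I.value B s) with h | h <;> rw [h]
    exacts [hA s, hB s]
  | impl A B hA hB =>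
    intro s; simp only [value]
    split_ifs
    exacts [hB s, hV.one_mem]
  | all x A hA =>
    intro s
    refine closure_minimal ?_ hV.isClosed (csInf_mem_closure (Set.range_nonempty _) ?_)
    · rintro _ ⟨d, rfl⟩; exact hA _
    · exact ⟨0, by rintro _ ⟨d, rfl⟩; exact (hV.subset_Icc (hA _)).1⟩
  | ex x A hA =>
    intro s
    refine closure_minimal ?_ hV.isClosed (csSup_mem_closure (Set.range_nonempty _) ?_)
    · rintro _ ⟨d, rfl⟩; exact hA _
    · exact ⟨1, by rintro _ ⟨d, rfl⟩; exact (hV.subset_Icc (hA _)).2⟩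

end Interpretation

/-- The Gödel logic based on `V`: all formulas that have value `1` in every interpretation based
on `V`, under every assignment to the variables. -/
def logic (V : Set ℝ) : Set Formula :=
  {A | ∀ (I : Interpretation.{u} V) (s : ℕ → I.D), I.value A s = 1}

/-- The prenex fragment of the Gödel logic based on `V`: its valid prenex formulas. -/
def prenexFragment (V : Set ℝ) : Set Formula :=
  {A | A.IsPrenex ∧ A ∈ logic.{u} V}

/-- The Gödel number of a term. -/
def Term.code : Term → ℕ
  | .var x => Nat.pair 0 x
  | .func _ f ts => Nat.pair 1 (Nat.pair f (Encodable.encode (List.ofFn fun i => (ts i).code)))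

/-- The Gödel number of a formula. -/
def Formula.code : Formula → ℕ
  | .falsum => Nat.pair 0 0
  | .pred _ p ts => Nat.pair 1 (Nat.pair p (Encodable.encode (List.ofFn fun i => (ts i).code)))
  | .conj A B => Nat.pair 2 (Nat.pair A.code B.code)
  | .disj A B => Nat.pair 3 (Nat.pair A.code B.code)
  | .impl A B => Nat.pair 4 (Nat.pair A.code B.code)
  | .all x A => Nat.pair 5 (Nat.pair x A.code)
  | .ex x A => Nat.pair 6 (Nat.pair x A.code)

theorem Term.code_injective : Function.Injective Term.code := by
  intro t
  induction t with
  | var x =>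
    rintro (y | ⟨m, g, us⟩) h
    · simpa [Term.code, Nat.pair_eq_pair] using h
    · simp [Term.code, Nat.pair_eq_pair] at h
  | func n f ts ih =>
    rintro (y | ⟨m, g, us⟩) h
    · simp [Term.code, Nat.pair_eq_pair] at h
    · simp only [Term.code, Nat.pair_eq_pair, true_and] at h
      obtain ⟨rfl, h⟩ := h
      have h' := Encodable.encode_injective h
      have hn : n = m := by simpa using congrArg List.length h'
      subst hn
      have h2 := List.ofFn_injective h'
      congr 1
      funext i
      exact ih i (congrFun h2 i)

/-- Distinct formulas have distinct Gödel numbers. -/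
theorem Formula.code_injective : Function.Injective Formula.code := by
  intro A
  induction A with
  | falsum =>
    intro B h
    cases B <;> simp [Formula.code, Nat.pair_eq_pair] at h ⊢
  | pred n p ts =>
    intro B h
    cases B <;> simp only [Formula.code, Nat.pair_eq_pair, true_and] at h <;>
      try (exfalso; omega)
    rename_i m q us
    obtain ⟨rfl, h⟩ := h
    have h' := Encodable.encode_injective h
    have hn : n = m := by simpa using congrArg List.length h'
    subst hn
    have h2 := List.ofFn_injective h'
    congr 1
    funext i
    exact Term.code_injective (congrFun h2 i)
  | conj A₁ A₂ h₁ h₂ | disj A₁ A₂ h₁ h₂ | impl A₁ A₂ h₁ h₂ =>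
    intro B h
    cases B <;> simp only [Formula.code, Nat.pair_eq_pair, true_and] at h <;>
      try (exfalso; omega)
    rw [h₁ h.1, h₂ h.2]
  | all x A hA | ex x A hA =>
    intro B h
    cases B <;> simp only [Formula.code, Nat.pair_eq_pair, true_and] at h <;>
      try (exfalso; omega)
    rw [h.1, hA h.2]

/-- A set of formulas is axiomatizable if it is recursively enumerable, that is, if the set of the
Gödel numbers of its elements is. -/
def IsAxiomatizable (S : Set Formula) : Prop :=
  REPred fun n : ℕ => ∃ A ∈ S, A.code = n

end GoedelLogic

/-!
The complement of the halting problem reduces to the prenex fragment, already to its purely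
existential formulas. The reduction rests on the fact that a closed set `V` containing the endpoints
of a complete binary tree of nested intervals, siblings being separated, is uncountable: distinct
branches have distinct suprema of left endpoints, and these suprema lie in `V`
(`not_countable_of_tree`). An infinite `V`, on the other hand, contains such trees of every finite
height, since it contains finite chains of every length.

The value of `B → A` is less than `1` exactly if that of `A` is less than that of `B`. So for a
rewriting system `R` and a closed term `t` there is an existential formula `noTree R m t` with value
less than `1` only if the binary predicates `lower` and `upper` are the endpoints of a tree of
intervals which has a level for every step of a run of `R` from `t`. Each interval carries a node of
the binary tree and the term reached so far, and a rewriting rule `l ↦ r` forces a nondegenerate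
interval labelled `l` to contain two nondegenerate ones labelled `r`. The Skolem functions of the
tree are function symbols of the language, so no quantifier alternation is needed.

* If `R` has an infinite run from `t`, the tree is infinite. As `V` is countable, the formula is
  then valid (`noTree_mem_logic_of_infinite_run`).
* If the runs from `t` are bounded, the tree can be finite, and the formula has a countermodel whose
  elements are the terms (`noTree_notMem_logic_of_bounded_run`).

The rules `machineRules` simulate an evaluator for the codes of `Turing.ToPartrec`, whose
continuations turn evaluation into steps that inspect the state to bounded depth only. With a
universal code one obtains formulas, with Gödel numbers computable from `e`, that are valid exactly
if the partial recursive function with code `e` is undefined at `0`; the set of these `e` is not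
recursively enumerable.
-/

namespace GoedelLogic

/-! ### Substitutions and existential closures -/

/-- Simultaneous substitution of terms for all variables. -/
def Term.subst (σ : ℕ → Term) : Term → Term
  | .var x => σ x
  | .func n f ts => .func n f fun i => (ts i).subst σ

namespace Interpretation

variable {V : Set ℝ}

theorem termValue_subst (I : Interpretation.{u} V) (s : ℕ → I.D) (σ : ℕ → Term) (t : Term) :
    I.termValue s (t.subst σ) = I.termValue (fun x => I.termValue s (σ x)) t := by
  induction t with
  | var x => rfl
  | func n f ts ih => simp only [Term.subst, termValue, ih]

end Interpretation

/-- The formula `∃ x_{n-1} … ∃ x_0 A`. -/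
def Formula.exs (A : Formula) : ℕ → Formula
  | 0 => A
  | n + 1 => .ex n (A.exs n)

theorem Formula.IsPrenex.exs {A : Formula} (hA : A.IsPrenex) : ∀ n, (A.exs n).IsPrenex
  | 0 => hA
  | n + 1 => .ex n (Formula.IsPrenex.exs hA n)

namespace Interpretation

variable {V : Set ℝ}

theorem value_le_value_exs (hV : IsTruthValueSet V) (I : Interpretation.{u} V) (A : Formula)
    (n : ℕ) {s s' : ℕ → I.D} (h : ∀ x, n ≤ x → s' x = s x) :
    I.value A s' ≤ I.value (A.exs n) s := by
  induction n generalizing s with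
  | zero => rw [funext fun x => h x (Nat.zero_le x)]; rfl
  | succ n ih =>
    refine (ih (s := Function.update s n (s' n)) fun x hx => ?_).trans
      (le_csSup ⟨1, ?_⟩ ⟨s' n, rfl⟩)
    · rcases hx.eq_or_lt with rfl | hx
      · simp
      · rw [Function.update_of_ne (by omega), h x hx]
    · rintro _ ⟨d, rfl⟩
      exact (hV.subset_Icc (I.value_mem hV _ _)).2

theorem value_exs_le (I : Interpretation.{u} V) (A : Formula) {c : ℝ} (n : ℕ) {s : ℕ → I.D}
    (h : ∀ s', (∀ x, n ≤ x → s' x = s x) → I.value A s' ≤ c) :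
    I.value (A.exs n) s ≤ c := by
  have := I.nonempty
  induction n generalizing s with
  | zero => exact h s fun _ _ => rfl
  | succ n ih =>
    refine csSup_le (Set.range_nonempty _) ?_
    rintro _ ⟨d, rfl⟩
    refine ih fun s' hs' => h s' fun x hx => ?_
    rw [hs' x (by omega), Function.update_of_ne (by omega)]

end Interpretation

/-! ### The formula attached to a rewriting system -/

/-- The root of the tree of binary words. -/
def rootTerm : Term := .func 0 6 ![]

/-- The child of the node `w` in the direction `b`. -/
def childTerm (b : Bool) (w : Term) : Term := .func 1 (if b then 2 else 1) ![w]

/-- The left endpoint of the interval at the node `w` with label `t`. -/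
def lower (w t : Term) : Formula := .pred 2 0 ![w, t]

/-- The right endpoint of the interval at the node `w` with label `t`. -/
def upper (w t : Term) : Formula := .pred 2 1 ![w, t]

/-- A formula with value less than `1` exactly if the value of `A` is less than that of `B`. -/
def notLess (A B : Formula) : Formula := .impl B A

/-- For a rewriting rule `l ↦ r`, a formula stating that the interval at `(x₀, l)` is nondegenerate,
but does not contain the intervals at the two children of `x₀`, with label `r`, as nondegenerate
and separated subintervals, the one at the child `false` to the left. -/
def ruleViolation (p : Term × Term) : Formula :=
  let a := lower (.var 0) p.1
  let b := upper (.var 0) p.1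
  let a₀ := lower (childTerm false (.var 0)) p.2
  let b₀ := upper (childTerm false (.var 0)) p.2
  let a₁ := lower (childTerm true (.var 0)) p.2
  let b₁ := upper (childTerm true (.var 0)) p.2
  .conj (.impl (.impl b a) b) <|
    .disj (notLess a a₀) <| .disj (notLess a₀ b₀) <| .disj (notLess b₀ a₁) <|
      .disj (notLess a₁ b₁) (notLess b₁ b)

/-- The disjunction of all ways in which the intervals can fail to form a tree over the run of the
rewriting system `R` from the term `t`: either the interval at the root, with label `t`, is
degenerate, or one of the rules is violated. -/
def violation (R : List (Term × Term)) (t : Term) : Formula :=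
  R.foldr (fun p A => .disj (ruleViolation p) A) (notLess (lower rootTerm t) (upper rootTerm t))

/-- The existential formula, over the first `m` variables, stating that the intervals do not form a
tree over the run of the rewriting system `R` from the term `t`. -/
def noTree (R : List (Term × Term)) (m : ℕ) (t : Term) : Formula := (violation R t).exs m

theorem noTree_isPrenex (R : List (Term × Term)) (m : ℕ) (t : Term) : (noTree R m t).IsPrenex := by
  refine Formula.IsPrenex.exs (.quantifierFree ?_) m
  induction R with
  | nil => exact .impl (.pred ..) (.pred ..)
  | cons p R ih =>
    refine .disj ?_ ih
    repeat' constructor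

namespace Interpretation

variable {V : Set ℝ}

/-- The left endpoint, as a function of the elements of the domain. -/
def lo (I : Interpretation.{u} V) (w t : I.D) : ℝ := I.pred 2 0 ![w, t]

/-- The right endpoint, as a function of the elements of the domain. -/
def hi (I : Interpretation.{u} V) (w t : I.D) : ℝ := I.pred 2 1 ![w, t]

/-- The child of a node, as a function of the elements of the domain. -/
def child (I : Interpretation.{u} V) (b : Bool) (w : I.D) : I.D :=
  I.func 1 (if b then 2 else 1) ![w]

theorem lo_mem (I : Interpretation.{u} V) (w t : I.D) : I.lo w t ∈ V := (I.pred 2 0 ![w, t]).2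

theorem value_lower (I : Interpretation.{u} V) (w t : Term) (s : ℕ → I.D) :
    I.value (lower w t) s = I.lo (I.termValue s w) (I.termValue s t) := by
  simp only [lower, value, lo]
  congr; funext i; fin_cases i <;> rfl

theorem value_upper (I : Interpretation.{u} V) (w t : Term) (s : ℕ → I.D) :
    I.value (upper w t) s = I.hi (I.termValue s w) (I.termValue s t) := by
  simp only [upper, value, hi]
  congr; funext i; fin_cases i <;> rfl

theorem termValue_childTerm (I : Interpretation.{u} V) (b : Bool) (w : Term) (s : ℕ → I.D) :
    I.termValue s (childTerm b w) = I.child b (I.termValue s w) := by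
  simp only [childTerm, termValue, child]
  congr; funext i; fin_cases i; rfl

theorem value_notLess (I : Interpretation.{u} V) (A B : Formula) (s : ℕ → I.D) :
    I.value (notLess A B) s = if I.value A s < I.value B s then I.value A s else 1 := rfl

theorem lt_of_value_notLess_lt (I : Interpretation.{u} V) {A B : Formula} {s : ℕ → I.D}
    (h : I.value (notLess A B) s < 1) : I.value A s < I.value B s := by
  by_contra hlt
  rw [value_notLess, if_neg hlt] at h
  exact h.false

theorem value_ruleViolation_le_value_violation (I : Interpretation.{u} V) {p : Term × Term}
    {t : Term} {R : List (Term × Term)} (hp : p ∈ R) (s : ℕ → I.D) :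
    I.value (ruleViolation p) s ≤ I.value (violation R t) s := by
  induction R with
  | nil => simp at hp
  | cons q R ih =>
    rcases List.mem_cons.1 hp with rfl | hp
    · exact le_max_left _ _
    · exact (ih hp).trans (le_max_right _ _)

theorem value_root_le_value_violation (I : Interpretation.{u} V) (R : List (Term × Term)) (t : Term)
    (s : ℕ → I.D) :
    I.value (notLess (lower rootTerm t) (upper rootTerm t)) s ≤ I.value (violation R t) s := by
  induction R with
  | nil => exact le_rfl
  | cons q R ih => exact ih.trans (le_max_right _ _)

theorem value_violation_le (I : Interpretation.{u} V) {R : List (Term × Term)} {t : Term}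
    {s : ℕ → I.D} {c : ℝ}
    (h₀ : I.value (notLess (lower rootTerm t) (upper rootTerm t)) s ≤ c)
    (h : ∀ p ∈ R, I.value (ruleViolation p) s ≤ c) : I.value (violation R t) s ≤ c := by
  induction R with
  | nil => exact h₀
  | cons q R ih =>
    exact max_le (h q List.mem_cons_self) (ih fun p hp => h p (List.mem_cons_of_mem _ hp))

/-- If the interval at a node is nondegenerate and a rule is not violated, then the intervals at
the children are arranged as the rule demands. -/
theorem chain_of_value_ruleViolation_lt (I : Interpretation.{u} V) {p : Term × Term}
    {s : ℕ → I.D} {w l r : I.D} (hw : s 0 = w) (hl : I.termValue s p.1 = l)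
    (hr : I.termValue s p.2 = r) (h : I.value (ruleViolation p) s < 1) (hlt : I.lo w l < I.hi w l) :
    I.lo w l < I.lo (I.child false w) r ∧
      I.lo (I.child false w) r < I.hi (I.child false w) r ∧
      I.hi (I.child false w) r < I.lo (I.child true w) r ∧
      I.lo (I.child true w) r < I.hi (I.child true w) r ∧
      I.hi (I.child true w) r < I.hi w l := by
  have hv : I.termValue s (.var 0) = w := hw
  rcases min_lt_iff.1 h with h | h
  · exfalso
    -- If `a < b`, then `(b → a) → b` has value `1`.
    simp only [value, value_lower, value_upper, hv, hl, gt_iff_lt, if_pos hlt,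
      if_neg hlt.not_gt, lt_irrefl] at h
  · obtain ⟨h₁, h⟩ := max_lt_iff.1 h
    obtain ⟨h₂, h⟩ := max_lt_iff.1 h
    obtain ⟨h₃, h⟩ := max_lt_iff.1 h
    obtain ⟨h₄, h₅⟩ := max_lt_iff.1 h
    have h₁ := I.lt_of_value_notLess_lt h₁
    have h₂ := I.lt_of_value_notLess_lt h₂
    have h₃ := I.lt_of_value_notLess_lt h₃
    have h₄ := I.lt_of_value_notLess_lt h₄
    have h₅ := I.lt_of_value_notLess_lt h₅
    simp only [value_lower, value_upper, termValue_childTerm, hv, hl, hr] at h₁ h₂ h₃ h₄ h₅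
    exact ⟨h₁, h₂, h₃, h₄, h₅⟩

/-- A rule that is not violated, at a node with a degenerate interval or with the intervals at the
children arranged as the rule demands, has a violation formula of value at most any bound `c < 1`
for the endpoints. This makes the supremum over all assignments less than `1`. -/
theorem value_ruleViolation_le_of_chain (I : Interpretation.{u} V) {p : Term × Term}
    {s : ℕ → I.D} {w l r : I.D} {c : ℝ} (hw : s 0 = w) (hl : I.termValue s p.1 = l)
    (hr : I.termValue s p.2 = r) (hc : ∀ w t, I.hi w t ≤ c) (hc₁ : c < 1)
    (h : I.hi w l ≤ I.lo w l ∨ (I.lo w l < I.lo (I.child false w) r ∧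
      I.lo (I.child false w) r < I.hi (I.child false w) r ∧
      I.hi (I.child false w) r < I.lo (I.child true w) r ∧
      I.lo (I.child true w) r < I.hi (I.child true w) r ∧
      I.hi (I.child true w) r < I.hi w l)) : I.value (ruleViolation p) s ≤ c := by
  have hv : I.termValue s (.var 0) = w := hw
  rcases h with h | ⟨h₁, h₂, h₃, h₄, h₅⟩
  · -- If `b ≤ a`, then `(b → a) → b` has the value of `b`.
    refine min_le_iff.2 (.inl ?_)
    have hn : ¬ I.lo w l < I.hi w l := h.not_gt
    simp only [value, value_lower, value_upper, hv, hl, gt_iff_lt, if_neg hn]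
    rw [if_pos ((hc w l).trans_lt hc₁)]
    exact hc w l
  · refine min_le_iff.2 (.inr ?_)
    simp only [value, value_notLess, value_lower, value_upper, termValue_childTerm, hv, hl, hr,
      if_pos h₁, if_pos h₂, if_pos h₃, if_pos h₄, if_pos h₅]
    have := hc w l
    refine max_le ?_ (max_le ?_ (max_le ?_ (max_le ?_ ?_))) <;> linarith

end Interpretation

/-! ### Infinite runs: the formula is valid -/

/-- One step of the rewriting system `R`; the rules apply to whole terms only. -/
def IsStep (R : List (Term × Term)) (t t' : Term) : Prop :=
  ∃ p ∈ R, ∃ σ, p.1.subst σ = t ∧ p.2.subst σ = t'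

/-- The rules contain no variables other than `x_1, …, x_{m-1}`. The variable `x_0` stands for a
node of the tree of words. -/
def HasVarsBelow (R : List (Term × Term)) (m : ℕ) : Prop :=
  ∀ p ∈ R, ∀ σ τ : ℕ → Term, (∀ x, 0 < x → x < m → σ x = τ x) →
    p.1.subst σ = p.1.subst τ ∧ p.2.subst σ = p.2.subst τ

/-- The term for a binary word. The head of the list is the last letter of the word. -/
def wordTerm : List Bool → Term
  | [] => rootTerm
  | b :: l => childTerm b (wordTerm l)

/-- The binary word of length `n` that a branch begins with, its last letter at the head. -/
def branchWord (β : ℕ → Bool) : ℕ → List Bool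
  | 0 => []
  | n + 1 => β n :: branchWord β n

theorem branchWord_congr {β γ : ℕ → Bool} {n : ℕ} (h : ∀ i < n, β i = γ i) :
    branchWord β n = branchWord γ n := by
  induction n with
  | zero => rfl
  | succ n ih => rw [branchWord, branchWord, h n n.lt_succ_self, ih fun i hi => h i (by omega)]

/-- A closed bounded set of reals that contains the endpoints of a complete binary tree of nested
intervals, with siblings separated, is uncountable: different branches have different suprema of
left endpoints. -/
theorem not_countable_of_tree {V : Set ℝ} (hV : IsTruthValueSet V) {a b : List Bool → ℝ}
    (ha : ∀ l, a l ∈ V) (hroot : a [] < b [])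
    (h : ∀ l, a l < b l → a l < a (false :: l) ∧ a (false :: l) < b (false :: l) ∧
      b (false :: l) < a (true :: l) ∧ a (true :: l) < b (true :: l) ∧ b (true :: l) < b l) :
    ¬ V.Countable := by
  have hlt : ∀ l, a l < b l := by
    intro l
    induction l with
    | nil => exact hroot
    | cons x l ih => cases x; exacts [(h l ih).2.1, (h l ih).2.2.2.1]
  have ha_mono : ∀ x l, a l ≤ a (x :: l) := by
    intro x l
    obtain ⟨h₁, h₂, h₃, h₄, h₅⟩ := h l (hlt l)
    cases x <;> linarith
  have hb_anti : ∀ x l, b (x :: l) ≤ b l := by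
    intro x l
    obtain ⟨h₁, h₂, h₃, h₄, h₅⟩ := h l (hlt l)
    cases x <;> linarith
  have hA : ∀ β, Monotone fun n => a (branchWord β n) :=
    fun β => monotone_nat_of_le_succ fun n => ha_mono _ _
  have hB : ∀ β, Antitone fun n => b (branchWord β n) :=
    fun β => antitone_nat_of_succ_le fun n => hb_anti _ _
  have hAB : ∀ β m n, a (branchWord β m) ≤ b (branchWord β n) := fun β m n =>
    (hA β (le_max_left m n)).trans ((hlt _).le.trans (hB β (le_max_right m n)))
  let f : (ℕ → Bool) → ℝ := fun β => sSup (Set.range fun n => a (branchWord β n))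
  have hbdd : ∀ β, BddAbove (Set.range fun n => a (branchWord β n)) := fun β =>
    ⟨b [], by rintro _ ⟨n, rfl⟩; exact hAB β n 0⟩
  have hfV : ∀ β, f β ∈ V := fun β =>
    closure_minimal (by rintro _ ⟨n, rfl⟩; exact ha _) hV.isClosed
      (csSup_mem_closure (Set.range_nonempty _) (hbdd β))
  have hf_lt : ∀ β γ : ℕ → Bool, ∀ n, (∀ i < n, β i = γ i) → β n = false → γ n = true →
      f β < f γ := by
    intro β γ n hn hβ hγ
    calc f β ≤ b (branchWord β (n + 1)) :=
          csSup_le (Set.range_nonempty _) (by rintro _ ⟨k, rfl⟩; exact hAB β k (n + 1))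
      _ < a (branchWord γ (n + 1)) := by
          rw [branchWord, branchWord, hβ, hγ, branchWord_congr hn]
          exact (h _ (hlt _)).2.2.1
      _ ≤ f γ := le_csSup (hbdd γ) ⟨n + 1, rfl⟩
  have hf : Function.Injective f := by
    intro β γ hβγ
    by_contra hne
    have h₁ := PiNat.apply_firstDiff_ne hne
    have h₂ : ∀ i < PiNat.firstDiff β γ, β i = γ i :=
      fun i hi => PiNat.apply_eq_of_lt_firstDiff hi
    cases hb : β (PiNat.firstDiff β γ) <;> cases hc : γ (PiNat.firstDiff β γ)
    · exact h₁ (hb.trans hc.symm)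
    · exact (hf_lt β γ _ h₂ hb hc).ne hβγ
    · exact (hf_lt γ β _ (fun i hi => (h₂ i hi).symm) hc hb).ne hβγ.symm
    · exact h₁ (hb.trans hc.symm)
  intro hcount
  have : Countable V := hcount
  have hc : Countable (ℕ → Bool) :=
    Function.Injective.countable (f := fun β => (⟨f β, hfV β⟩ : V)) fun β γ hβγ =>
      hf (congrArg Subtype.val hβγ)
  -- An injection of `ℕ → Bool` into `ℕ` contradicts Cantor's theorem.
  obtain ⟨e, he⟩ := exists_injective_nat (ℕ → Bool)
  refine Function.cantor_injective (fun S : Set ℕ => e fun n => @decide (n ∈ S) (Classical.dec _))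
    fun S T hST => Set.ext fun n => ?_
  simpa using congrFun (he hST) n

/-- If the rewriting system has an infinite run, then an interpretation that gives the formula a
value less than `1` provides an infinite tree of intervals with endpoints in `V`. -/
theorem noTree_mem_logic_of_infinite_run {V : Set ℝ} (hV : IsTruthValueSet V) (hc : V.Countable)
    {R : List (Term × Term)} {m : ℕ} (hm : 0 < m) (hR : HasVarsBelow R m) {t : ℕ → Term}
    (ht : ∀ n, IsStep R (t n) (t (n + 1))) : noTree R m (t 0) ∈ logic.{u} V := by
  intro I s
  by_contra hne
  have hlt : I.value (noTree R m (t 0)) s < 1 :=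
    lt_of_le_of_ne (hV.subset_Icc (I.value_mem hV _ _)).2 hne
  have hviol : ∀ s', (∀ x, m ≤ x → s' x = s x) → I.value (violation R (t 0)) s' < 1 :=
    fun s' hs' => (I.value_le_value_exs hV _ m hs').trans_lt hlt
  refine not_countable_of_tree hV
    (a := fun l => I.lo (I.termValue s (wordTerm l)) (I.termValue s (t l.length)))
    (b := fun l => I.hi (I.termValue s (wordTerm l)) (I.termValue s (t l.length)))
    (fun l => I.lo_mem _ _) ?_ (fun l hl => ?_) hc
  · have := I.lt_of_value_notLess_lt
      ((I.value_root_le_value_violation R (t 0) s).trans_lt (hviol s fun _ _ => rfl))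
    rwa [I.value_lower, I.value_upper] at this
  · obtain ⟨p, hp, σ, h₁, h₂⟩ := ht l.length
    -- The assignment has to agree with `s` from `m` on, and `x₀` has to denote the node `l`.
    let τ : ℕ → Term := fun x => if x = 0 then wordTerm l else if x < m then σ x else .var x
    have hτ := hR p hp τ σ fun x h0 hx => by simp [τ, h0.ne', hx]
    have hs' := hviol (fun x => I.termValue s (τ x)) fun x hx => by
      simp [τ, hx.not_gt, (hm.trans_le hx).ne', Interpretation.termValue]
    have := I.chain_of_value_ruleViolation_lt (p := p) (w := I.termValue s (wordTerm l))
      (l := I.termValue s (t l.length)) (r := I.termValue s (t (l.length + 1)))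
      (by simp [τ]) (by rw [← I.termValue_subst, hτ.1, h₁]) (by rw [← I.termValue_subst, hτ.2, h₂])
      ((I.value_ruleViolation_le_value_violation hp _).trans_lt hs') hl
    simpa only [wordTerm, I.termValue_childTerm, List.length_cons] using this

/-! ### Bounded runs: the formula has a countermodel -/

/-- `IsRun R t₀ n t` means that `n` steps of the rewriting system `R` lead from `t₀` to `t`. -/
def IsRun (R : List (Term × Term)) (t₀ : Term) : ℕ → Term → Prop
  | 0, t => t = t₀
  | n + 1, t => ∃ t', IsRun R t₀ n t' ∧ IsStep R t' t

theorem wordTerm_injective : Function.Injective wordTerm := by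
  intro l
  induction l with
  | nil =>
    rintro (_ | ⟨y, l'⟩) h
    · rfl
    · simp [wordTerm, rootTerm, childTerm] at h
  | cons x l ih =>
    rintro (_ | ⟨y, l'⟩) h
    · simp [wordTerm, rootTerm, childTerm] at h
    · simp only [wordTerm, childTerm, Term.func.injEq, heq_eq_eq, true_and] at h
      rw [ih (congrFun h.2 0)]
      cases x <;> cases y <;> simp_all

/-- The length of the intervals of height `k` in a finite tree of intervals of natural numbers. -/
def intervalLength : ℕ → ℕ
  | 0 => 1
  | k + 1 => 2 * intervalLength k + 3

/-- The left endpoint of the interval at a word in the tree of height `N` of intervals of natural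
numbers; the interval has length `intervalLength (N - l.length)`. -/
def intervalStart (N : ℕ) : List Bool → ℕ
  | [] => 0
  | x :: l => intervalStart N l + if x then intervalLength (N - (l.length + 1)) + 2 else 1

/-- The right endpoint of the interval at a word in the tree of height `N` of intervals of natural
numbers. -/
def intervalEnd (N : ℕ) (l : List Bool) : ℕ := intervalStart N l + intervalLength (N - l.length)

theorem intervalLength_pos (k : ℕ) : 0 < intervalLength k := by
  cases k <;> simp [intervalLength]

theorem intervalStart_lt_intervalEnd (N : ℕ) (l : List Bool) :
    intervalStart N l < intervalEnd N l :=
  Nat.lt_add_of_pos_right (intervalLength_pos _)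

theorem interval_chain {N : ℕ} {l : List Bool} (hl : l.length < N) :
    intervalStart N l < intervalStart N (false :: l) ∧
      intervalStart N (false :: l) < intervalEnd N (false :: l) ∧
      intervalEnd N (false :: l) < intervalStart N (true :: l) ∧
      intervalStart N (true :: l) < intervalEnd N (true :: l) ∧
      intervalEnd N (true :: l) < intervalEnd N l := by
  have h : intervalLength (N - l.length) = 2 * intervalLength (N - (l.length + 1)) + 3 := by
    rw [show N - l.length = N - (l.length + 1) + 1 by omega]; rfl
  have := intervalLength_pos (N - (l.length + 1))
  simp only [intervalEnd, intervalStart, List.length_cons, h]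
  simp only [Bool.false_eq_true, if_false, if_true]
  omega

theorem intervalEnd_le {N : ℕ} {l : List Bool} (hl : l.length ≤ N) :
    intervalEnd N l ≤ intervalEnd N [] := by
  induction l with
  | nil => exact le_rfl
  | cons x l ih =>
    have h := interval_chain (N := N) (l := l) (by simpa using hl)
    have := ih (by simp at hl; omega)
    cases x <;> omega

/-- An infinite truth value set contains finite chains below `1` of any length. -/
theorem exists_strictMonoOn_lt_one {V : Set ℝ} (hV : IsTruthValueSet V) (hinf : V.Infinite)
    (K : ℕ) : ∃ g : ℕ → V, StrictMonoOn g (Set.Iic K) ∧ ∀ n, g n ≤ g K ∧ (g n : ℝ) < 1 := by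
  obtain ⟨T, hT, hcard⟩ :=
    (hinf.sdiff (Set.finite_singleton (1 : ℝ))).exists_subset_card_eq (K + 1)
  let e := T.orderEmbOfFin hcard
  have he : ∀ i, e i ∈ V ∧ e i ≠ 1 := fun i => by
    simpa using hT (T.orderEmbOfFin_mem hcard i)
  refine ⟨fun n => ⟨e ⟨min n K, by omega⟩, (he _).1⟩, fun i hi j hj hij => ?_, fun n => ⟨?_, ?_⟩⟩
  · simp only [Set.mem_Iic] at hi hj
    refine Subtype.mk_lt_mk.2 (e.strictMono (Fin.mk_lt_mk.2 ?_))
    omega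
  · exact Subtype.mk_le_mk.2 (e.monotone (Fin.mk_le_mk.2 (by omega)))
  · exact lt_of_le_of_ne (hV.subset_Icc (he _).1).2 (he _).2

/-- The interpretation by terms in which only the predicates `lower` and `upper` are not constantly
equal to `z`. -/
def termModel {V : Set ℝ} (z : V) (a b : Term → Term → V) : Interpretation.{u} V where
  D := ULift Term
  nonempty := ⟨⟨.var 0⟩⟩
  func n f ts := ⟨.func n f fun i => (ts i).down⟩
  pred
    | 2, 0, ts => a (ts 0).down (ts 1).down
    | 2, 1, ts => b (ts 0).down (ts 1).down
    | _, _, _ => z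

theorem termValue_termModel {V : Set ℝ} (z : V) (a b : Term → Term → V)
    (s : ℕ → (termModel.{u} z a b).D) (t : Term) :
    (termModel.{u} z a b).termValue s t = ⟨t.subst fun x => (s x).down⟩ := by
  induction t with
  | var x => rfl
  | func n f ts ih => simp only [Interpretation.termValue, ih]; rfl

theorem child_termModel {V : Set ℝ} (z : V) (a b : Term → Term → V) (x : Bool) (w : Term) :
    (termModel.{u} z a b).child x ⟨w⟩ = ⟨childTerm x w⟩ := by
  simp only [Interpretation.child, termModel, childTerm]
  congr; funext i; fin_cases i; rfl

/-- If the runs of the rewriting system from a closed term are bounded, then the tree of intervals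
over them is finite, and a finite chain of truth values suffices for a countermodel. -/
theorem noTree_notMem_logic_of_bounded_run {V : Set ℝ} (hV : IsTruthValueSet V) (hinf : V.Infinite)
    {R : List (Term × Term)} (m : ℕ) {t₀ : Term}
    (ht₀ : ∀ σ, t₀.subst σ = t₀) {N : ℕ} (hN : ∀ n t, IsRun R t₀ n t → n ≤ N) :
    noTree R m t₀ ∉ logic.{u} V := by
  classical
  obtain ⟨g, hg, hg₁⟩ := exists_strictMonoOn_lt_one hV hinf (intervalEnd N [])
  let z : V := ⟨0, hV.zero_mem⟩
  let Active : Term → Term → Prop := fun w t => ∃ l, wordTerm l = w ∧ IsRun R t₀ l.length t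
  let word : Term → List Bool := Function.invFun wordTerm
  let a : Term → Term → V := fun w t => if Active w t then g (intervalStart N (word w)) else z
  let b : Term → Term → V := fun w t => if Active w t then g (intervalEnd N (word w)) else z
  let I := termModel.{u} z a b
  have hword : ∀ l, word (wordTerm l) = l := Function.leftInverse_invFun wordTerm_injective
  have hlo : ∀ l t, IsRun R t₀ l.length t → I.lo ⟨wordTerm l⟩ ⟨t⟩ = g (intervalStart N l) := by
    intro l t h
    change ((a (wordTerm l) t : V) : ℝ) = _
    simp only [a, hword]
    rw [if_pos ⟨l, rfl, h⟩]
  have hhi : ∀ l t, IsRun R t₀ l.length t → I.hi ⟨wordTerm l⟩ ⟨t⟩ = g (intervalEnd N l) := by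
    intro l t h
    change ((b (wordTerm l) t : V) : ℝ) = _
    simp only [b, hword]
    rw [if_pos ⟨l, rfl, h⟩]
  have hg_lt : ∀ i j, i < j → j ≤ intervalEnd N [] → (g i : ℝ) < g j :=
    fun i j hij hj => hg (hij.le.trans hj) hj hij
  let c : ℝ := g (intervalEnd N [])
  have hc₁ : c < 1 := (hg₁ _).2
  have hc : ∀ w t, I.hi w t ≤ c := by
    intro w t
    change ((b w.down t.down : V) : ℝ) ≤ c
    simp only [b]
    split_ifs
    · exact (hg₁ _).1
    · exact (hV.subset_Icc (g _).2).1
  intro hvalid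
  refine (lt_of_le_of_lt ?_ hc₁).ne (hvalid I fun x => ⟨.var x⟩)
  refine I.value_exs_le _ m fun s _ => I.value_violation_le ?_ fun p hp => ?_
  · have hrun : IsRun R t₀ ([] : List Bool).length t₀ := rfl
    have hroot : I.termValue s rootTerm = ⟨wordTerm []⟩ := by
      rw [termValue_termModel]; simp only [rootTerm, Term.subst, wordTerm]
      congr; funext i; exact i.elim0
    have h := hg_lt _ _ (intervalStart_lt_intervalEnd N []) le_rfl
    rw [I.value_notLess, I.value_lower, I.value_upper, hroot, termValue_termModel, ht₀,
      hlo [] t₀ hrun, hhi [] t₀ hrun, if_pos h]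
    exact h.le
  · refine I.value_ruleViolation_le_of_chain rfl (termValue_termModel ..)
      (termValue_termModel ..) hc hc₁ ?_
    set l := p.1.subst fun x => (s x).down with hl
    set r := p.2.subst fun x => (s x).down with hr
    by_cases hact : Active (s 0).down l
    · right
      obtain ⟨v, hv, hrun⟩ := hact
      have hs0 : s 0 = ⟨wordTerm v⟩ := by rw [hv]; rfl
      have hrun' : ∀ x : Bool, IsRun R t₀ (x :: v).length r := fun x =>
        ⟨l, hrun, p, hp, _, hl.symm, hr.symm⟩
      have hvN : v.length + 1 ≤ N := hN _ _ (hrun' true)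
      obtain ⟨h₁, h₂, h₃, h₄, h₅⟩ := interval_chain hvN
      have h₆ := intervalEnd_le (Nat.le_of_succ_le hvN)
      have hch : ∀ x, I.child x ⟨wordTerm v⟩ = ⟨wordTerm (x :: v)⟩  :=
        fun x => child_termModel z a b x _
      rw [hs0, hch, hch, hlo v l hrun, hhi v l hrun, hlo _ r (hrun' false), hhi _ r (hrun' false),
        hlo _ r (hrun' true), hhi _ r (hrun' true)]
      refine ⟨hg_lt _ _ h₁ ?_, hg_lt _ _ h₂ ?_, hg_lt _ _ h₃ ?_, hg_lt _ _ h₄ ?_,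
        hg_lt _ _ h₅ ?_⟩ <;> omega
    · left
      change ((b (s 0).down l : V) : ℝ) ≤ (a (s 0).down l : V)
      simp only [a, b, if_neg hact]
      exact le_rfl

/-! ### A rewriting system for partial recursive functions -/

open Turing StateTransition

/-- The term with the `f`-th unary function symbol at its head. -/
def app₁ (f : ℕ) (a : Term) : Term := .func 1 f ![a]

/-- The term with the `f`-th binary function symbol at its head. -/
def app₂ (f : ℕ) (a b : Term) : Term := .func 2 f ![a, b]

/-- The term with the `f`-th ternary function symbol at its head. -/
def app₃ (f : ℕ) (a b c : Term) : Term := .func 3 f ![a, b, c]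

/-- The `f`-th constant. -/
def const (f : ℕ) : Term := .func 0 f ![]

@[simp]
theorem subst_const (σ : ℕ → Term) (f : ℕ) : (const f).subst σ = const f := by
  simp only [const, Term.subst]; congr; funext i; exact i.elim0

@[simp]
theorem subst_app₁ (σ : ℕ → Term) (f : ℕ) (a : Term) :
    (app₁ f a).subst σ = app₁ f (a.subst σ) := by
  simp only [app₁, Term.subst]; congr; funext i; fin_cases i; rfl

@[simp]
theorem subst_app₂ (σ : ℕ → Term) (f : ℕ) (a b : Term) :
    (app₂ f a b).subst σ = app₂ f (a.subst σ) (b.subst σ) := by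
  simp only [app₂, Term.subst]; congr; funext i; fin_cases i <;> rfl

@[simp]
theorem subst_app₃ (σ : ℕ → Term) (f : ℕ) (a b c : Term) :
    (app₃ f a b c).subst σ = app₃ f (a.subst σ) (b.subst σ) (c.subst σ) := by
  simp only [app₃, Term.subst]; congr; funext i; fin_cases i <;> rfl

@[simp]
theorem const_inj {f g : ℕ} : const f = const g ↔ f = g := by simp [const]

@[simp]
theorem app₁_inj {f g : ℕ} {a a' : Term} : app₁ f a = app₁ g a' ↔ f = g ∧ a = a' := by
  simp [app₁]

@[simp]
theorem app₂_inj {f g : ℕ} {a b a' b' : Term} :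
    app₂ f a b = app₂ g a' b' ↔ f = g ∧ a = a' ∧ b = b' := by
  simp [app₂]

@[simp]
theorem app₃_inj {f g : ℕ} {a b c a' b' c' : Term} :
    app₃ f a b c = app₃ g a' b' c' ↔ f = g ∧ a = a' ∧ b = b' ∧ c = c' := by
  simp [app₃]

@[simp] theorem const_ne_app₁ {f g : ℕ} {a : Term} : const f ≠ app₁ g a := by simp [const, app₁]

@[simp] theorem app₁_ne_const {f g : ℕ} {a : Term} : app₁ g a ≠ const f := by simp [const, app₁]

@[simp] theorem const_ne_app₂ {f g : ℕ} {a b : Term} : const f ≠ app₂ g a b := by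
  simp [const, app₂]

@[simp] theorem app₂_ne_const {f g : ℕ} {a b : Term} : app₂ g a b ≠ const f := by
  simp [const, app₂]

@[simp] theorem const_ne_app₃ {f g : ℕ} {a b c : Term} : const f ≠ app₃ g a b c := by
  simp [const, app₃]

@[simp] theorem app₃_ne_const {f g : ℕ} {a b c : Term} : app₃ g a b c ≠ const f := by
  simp [const, app₃]

@[simp] theorem app₁_ne_app₂ {f g : ℕ} {a a' b' : Term} : app₁ f a ≠ app₂ g a' b' := by
  simp [app₁, app₂]

@[simp] theorem app₂_ne_app₁ {f g : ℕ} {a a' b' : Term} : app₂ g a' b' ≠ app₁ f a := by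
  simp [app₁, app₂]

@[simp] theorem app₂_ne_app₃ {f g : ℕ} {a b a' b' c' : Term} :
    app₂ f a b ≠ app₃ g a' b' c' := by
  simp [app₂, app₃]

@[simp] theorem app₃_ne_app₂ {f g : ℕ} {a b a' b' c' : Term} :
    app₃ g a' b' c' ≠ app₂ f a b := by
  simp [app₂, app₃]

/-- The states of a machine that evaluates the codes of `Turing.ToPartrec`. Unlike in
`Turing.ToPartrec.Cfg`, the evaluation of a code in a continuation is a state too, so that a step
of the machine inspects its state only to bounded depth. -/
inductive MachineState
  | eval (c : ToPartrec.Code) (k : ToPartrec.Cont) (v : List ℕ)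
  | ret (k : ToPartrec.Cont) (v : List ℕ)
  | halted

/-- One step of the machine that evaluates the codes of `Turing.ToPartrec`. -/
def machineStep : MachineState → Option MachineState
  | .eval .zero' k v => some (.ret k (0 :: v))
  | .eval .succ k [] => some (.ret k [1])
  | .eval .succ k (x :: _) => some (.ret k [x + 1])
  | .eval .tail k [] => some (.ret k [])
  | .eval .tail k (_ :: v) => some (.ret k v)
  | .eval (.cons f g) k v => some (.eval f (.cons₁ g v k) v)
  | .eval (.comp f g) k v => some (.eval g (.comp f k) v)
  | .eval (.case f _) k [] => some (.eval f k [])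
  | .eval (.case f _) k (0 :: v) => some (.eval f k v)
  | .eval (.case _ g) k ((x + 1) :: v) => some (.eval g k (x :: v))
  | .eval (.fix f) k v => some (.eval f (.fix f k) v)
  | .ret .halt _ => some .halted
  | .ret (.cons₁ g as k) v => some (.eval g (.cons₂ v k) as)
  | .ret (.cons₂ [] k) v => some (.ret k (0 :: v))
  | .ret (.cons₂ (x :: _) k) v => some (.ret k (x :: v))
  | .ret (.comp f k) v => some (.eval f k v)
  | .ret (.fix _ k) [] => some (.ret k [])
  | .ret (.fix _ k) (0 :: v) => some (.ret k v)
  | .ret (.fix f k) ((_ + 1) :: v) => some (.eval f (.fix f k) v)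
  | .halted => none

/-- The machine state for a configuration of `Turing.ToPartrec`. -/
def ofCfg : ToPartrec.Cfg → MachineState
  | .halt _ => .halted
  | .ret k v => .ret k v

theorem reaches_stepNormal (c : ToPartrec.Code) (k : ToPartrec.Cont) (v : List ℕ) :
    Reaches₁ machineStep (.eval c k v) (ofCfg (ToPartrec.stepNormal c k v)) := by
  induction c generalizing k v with
  | zero' => exact .single rfl
  | succ => cases v <;> exact .single rfl
  | tail => cases v <;> exact .single rfl
  | cons f g hf _ => exact (hf _ _).head rfl
  | comp f g _ hg => exact (hg _ _).head rfl
  | case f g hf hg =>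
    rcases v with _ | ⟨_ | x, v⟩
    · exact (hf _ _).head rfl
    · exact (hf _ _).head rfl
    · exact (hg _ _).head rfl
  | fix f hf => exact (hf _ _).head rfl

theorem reaches_stepRet (k : ToPartrec.Cont) (v : List ℕ) :
    Reaches₁ machineStep (.ret k v) (ofCfg (ToPartrec.stepRet k v)) := by
  induction k generalizing v with
  | halt => exact .single rfl
  | cons₁ g as k _ => exact (reaches_stepNormal _ _ _).head rfl
  | cons₂ ns k ih => cases ns <;> exact (ih _).head rfl
  | comp f k _ => exact (reaches_stepNormal _ _ _).head rfl
  | fix f k ih =>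
    rcases v with _ | ⟨_ | x, v⟩
    · exact (ih _).head rfl
    · exact (ih _).head rfl
    · exact (reaches_stepNormal _ _ _).head rfl

/-- The machine started on a code halts exactly if the code is defined at the input. -/
theorem machine_halts_iff (c : ToPartrec.Code) (v : List ℕ) :
    (eval machineStep (.eval c .halt v)).Dom ↔ (c.eval v).Dom := by
  have H : Respects ToPartrec.step machineStep fun a b => ofCfg a = b := by
    rw [fun_respects]
    rintro (v | ⟨k, v⟩)
    · rfl
    · exact reaches_stepRet k v
  rw [reaches_eval (reaches_stepNormal c .halt v).to_reflTransGen, tr_eval_dom H rfl,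
    ToPartrec.stepNormal_eval]
  rfl

/-- The term for a natural number. -/
def natTerm : ℕ → Term
  | 0 => const 1
  | n + 1 => app₁ 0 (natTerm n)

/-- The term for a list of natural numbers. -/
def listTerm : List ℕ → Term
  | [] => const 0
  | x :: v => app₂ 0 (natTerm x) (listTerm v)

/-- The term for a code. -/
def codeTerm : ToPartrec.Code → Term
  | .zero' => const 2
  | .succ => const 3
  | .tail => const 4
  | .cons f g => app₂ 1 (codeTerm f) (codeTerm g)
  | .comp f g => app₂ 2 (codeTerm f) (codeTerm g)
  | .case f g => app₂ 3 (codeTerm f) (codeTerm g)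
  | .fix f => app₁ 3 (codeTerm f)

/-- The term for a continuation. -/
def contTerm : ToPartrec.Cont → Term
  | .halt => const 5
  | .cons₁ g v k => app₃ 0 (codeTerm g) (listTerm v) (contTerm k)
  | .cons₂ v k => app₂ 4 (listTerm v) (contTerm k)
  | .comp f k => app₂ 5 (codeTerm f) (contTerm k)
  | .fix f k => app₂ 6 (codeTerm f) (contTerm k)

/-- The term for a state of the machine. -/
def stateTerm : MachineState → Term
  | .eval c k v => app₃ 1 (codeTerm c) (contTerm k) (listTerm v)
  | .ret k v => app₂ 7 (contTerm k) (listTerm v)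
  | .halted => const 7

/-- The rewriting rules of the machine, clause by clause those of `machineStep`. The variables are
`1` for the continuation, `2` for the list, `3` and `4` for codes, `5` for a number, and `6` for a
second list. -/
def machineRules : List (Term × Term) :=
  let k : Term := .var 1
  let v : Term := .var 2
  let f : Term := .var 3
  let g : Term := .var 4
  let x : Term := .var 5
  let u : Term := .var 6
  let nil := const 0
  let zero := const 1
  let succ := app₁ 0
  let cons := app₂ 0
  let eval := app₃ 1
  let ret := app₂ 7
  [ (eval (const 2) k v, ret k (cons zero v)),
    (eval (const 3) k nil, ret k (cons (succ zero) nil)),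
    (eval (const 3) k (cons x v), ret k (cons (succ x) nil)),
    (eval (const 4) k nil, ret k nil),
    (eval (const 4) k (cons x v), ret k v),
    (eval (app₂ 1 f g) k v, eval f (app₃ 0 g v k) v),
    (eval (app₂ 2 f g) k v, eval g (app₂ 5 f k) v),
    (eval (app₂ 3 f g) k nil, eval f k nil),
    (eval (app₂ 3 f g) k (cons zero v), eval f k v),
    (eval (app₂ 3 f g) k (cons (succ x) v), eval g k (cons x v)),
    (eval (app₁ 3 f) k v, eval f (app₂ 6 f k) v),
    (ret (const 5) v, const 7),
    (ret (app₃ 0 g u k) v, eval g (app₂ 4 v k) u),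
    (ret (app₂ 4 nil k) v, ret k (cons zero v)),
    (ret (app₂ 4 (cons x u) k) v, ret k (cons x v)),
    (ret (app₂ 5 f k) v, eval f k v),
    (ret (app₂ 6 f k) nil, ret k nil),
    (ret (app₂ 6 f k) (cons zero v), ret k v),
    (ret (app₂ 6 f k) (cons (succ x) v), eval f (app₂ 6 f k) v) ]

theorem machineRules_hasVarsBelow : HasVarsBelow machineRules 7 := by
  intro p hp σ τ h
  have h₁ := h 1 (by norm_num) (by norm_num)
  have h₂ := h 2 (by norm_num) (by norm_num)
  have h₃ := h 3 (by norm_num) (by norm_num)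
  have h₄ := h 4 (by norm_num) (by norm_num)
  have h₅ := h 5 (by norm_num) (by norm_num)
  have h₆ := h 6 (by norm_num) (by norm_num)
  simp only [machineRules, List.mem_cons, List.not_mem_nil, or_false] at hp
  rcases hp with rfl | rfl | rfl | rfl | rfl | rfl | rfl | rfl | rfl | rfl | rfl | rfl | rfl |
    rfl | rfl | rfl | rfl | rfl | rfl <;>
    simp [Term.subst, h₁, h₂, h₃, h₄, h₅, h₆]

/-- The substitution for the variables of `machineRules`. -/
def machineSubst (k v f g x u : Term) : ℕ → Term
  | 1 => k
  | 2 => v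
  | 3 => f
  | 4 => g
  | 5 => x
  | _ => u

/-- From the term of a state, the rewriting system makes no steps other than those of the
machine. -/
theorem machineStep_of_isStep {q : MachineState} {t : Term}
    (h : IsStep machineRules (stateTerm q) t) :
    ∃ q', machineStep q = some q' ∧ t = stateTerm q' := by
  obtain ⟨p, hp, σ, h₁, h₂⟩ := h
  simp only [machineRules, List.mem_cons, List.not_mem_nil, or_false] at hp
  -- Comparing the left-hand sides of the rules with `stateTerm q`, only one rule remains.
  fun_cases machineStep q <;>
  (simp only [Option.some.injEq, exists_eq_left', stateTerm, codeTerm, contTerm, listTerm,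
     natTerm] at h₁ ⊢
   rcases hp with rfl | rfl | rfl | rfl | rfl | rfl | rfl | rfl | rfl | rfl | rfl | rfl | rfl |
    rfl | rfl | rfl | rfl | rfl | rfl <;>
   simp [Term.subst] at h₁ h₂ <;> simp_all)

/-- Every step of the machine is a step of the rewriting system. -/
theorem isStep_of_machineStep {q q' : MachineState} (h : machineStep q = some q') :
    IsStep machineRules (stateTerm q) (stateTerm q') := by
  -- It suffices that some rule applies, since every step of the rewriting system is one of the
  -- machine, and the machine is deterministic.
  suffices hσ : ∃ p ∈ machineRules, ∃ σ, p.1.subst σ = stateTerm q by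
    obtain ⟨p, hp, σ, hσ⟩ := hσ
    obtain ⟨q'', hq'', ht⟩ := machineStep_of_isStep ⟨p, hp, σ, hσ, rfl⟩
    rw [h, Option.some.injEq] at hq''
    exact ⟨p, hp, σ, hσ, hq'' ▸ ht⟩
  -- The value of the variables that do not occur in a rule is immaterial.
  let nil : Term := const 0
  have key : ∀ (i : ℕ) (hi : i < machineRules.length) (σ : ℕ → Term) (t : Term),
      machineRules[i].1.subst σ = t → ∃ p ∈ machineRules, ∃ σ, p.1.subst σ = t :=
    fun i hi σ t h => ⟨_, List.getElem_mem hi, σ, h⟩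
  revert h
  fun_cases machineStep q <;> intro h <;>
    simp only [stateTerm, codeTerm, contTerm, listTerm, natTerm]
  · next k v =>
    exact key 0 (by decide) (machineSubst (contTerm k) (listTerm v) nil nil nil nil) _
      (by simp [machineRules, machineSubst, Term.subst])
  · next k =>
    exact key 1 (by decide) (machineSubst (contTerm k) nil nil nil nil nil) _
      (by simp [machineRules, machineSubst, Term.subst])
  · next k x v =>
    exact key 2 (by decide) (machineSubst (contTerm k) (listTerm v) nil nil (natTerm x) nil) _
      (by simp [machineRules, machineSubst, Term.subst])
  · next k =>
    exact key 3 (by decide) (machineSubst (contTerm k) nil nil nil nil nil) _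
      (by simp [machineRules, machineSubst, Term.subst])
  · next k x v =>
    exact key 4 (by decide) (machineSubst (contTerm k) (listTerm v) nil nil (natTerm x) nil) _
      (by simp [machineRules, machineSubst, Term.subst])
  · next f g k v =>
    exact key 5 (by decide)
      (machineSubst (contTerm k) (listTerm v) (codeTerm f) (codeTerm g) nil nil) _
      (by simp [machineRules, machineSubst, Term.subst])
  · next f g k v =>
    exact key 6 (by decide)
      (machineSubst (contTerm k) (listTerm v) (codeTerm f) (codeTerm g) nil nil) _
      (by simp [machineRules, machineSubst, Term.subst])
  · next f g k =>
    exact key 7 (by decide) (machineSubst (contTerm k) nil (codeTerm f) (codeTerm g) nil nil) _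
      (by simp [machineRules, machineSubst, Term.subst])
  · next f g k v =>
    exact key 8 (by decide)
      (machineSubst (contTerm k) (listTerm v) (codeTerm f) (codeTerm g) nil nil) _
      (by simp [machineRules, machineSubst, Term.subst])
  · next f g k x v =>
    exact key 9 (by decide)
      (machineSubst (contTerm k) (listTerm v) (codeTerm f) (codeTerm g) (natTerm x) nil) _
      (by simp [machineRules, machineSubst, Term.subst])
  · next f k v =>
    exact key 10 (by decide) (machineSubst (contTerm k) (listTerm v) (codeTerm f) nil nil nil) _
      (by simp [machineRules, machineSubst, Term.subst])
  · next v =>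
    exact key 11 (by decide) (machineSubst nil (listTerm v) nil nil nil nil) _
      (by simp [machineRules, machineSubst, Term.subst])
  · next g u k v =>
    exact key 12 (by decide)
      (machineSubst (contTerm k) (listTerm v) nil (codeTerm g) nil (listTerm u)) _
      (by simp [machineRules, machineSubst, Term.subst])
  · next k v =>
    exact key 13 (by decide) (machineSubst (contTerm k) (listTerm v) nil nil nil nil) _
      (by simp [machineRules, machineSubst, Term.subst])
  · next x u k v =>
    exact key 14 (by decide)
      (machineSubst (contTerm k) (listTerm v) nil nil (natTerm x) (listTerm u)) _
      (by simp [machineRules, machineSubst, Term.subst])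
  · next f k v =>
    exact key 15 (by decide) (machineSubst (contTerm k) (listTerm v) (codeTerm f) nil nil nil) _
      (by simp [machineRules, machineSubst, Term.subst])
  · next f k =>
    exact key 16 (by decide) (machineSubst (contTerm k) nil (codeTerm f) nil nil nil) _
      (by simp [machineRules, machineSubst, Term.subst])
  · next f k v =>
    exact key 17 (by decide) (machineSubst (contTerm k) (listTerm v) (codeTerm f) nil nil nil) _
      (by simp [machineRules, machineSubst, Term.subst])
  · next f k x v =>
    exact key 18 (by decide)
      (machineSubst (contTerm k) (listTerm v) (codeTerm f) nil (natTerm x) nil) _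
      (by simp [machineRules, machineSubst, Term.subst])
  · cases h

@[simp]
theorem subst_natTerm (σ : ℕ → Term) (n : ℕ) : (natTerm n).subst σ = natTerm n := by
  induction n <;> simp_all [natTerm]

@[simp]
theorem subst_listTerm (σ : ℕ → Term) (v : List ℕ) : (listTerm v).subst σ = listTerm v := by
  induction v <;> simp_all [listTerm]

@[simp]
theorem subst_codeTerm (σ : ℕ → Term) (c : ToPartrec.Code) :
    (codeTerm c).subst σ = codeTerm c := by
  induction c <;> simp_all [codeTerm]

@[simp]
theorem subst_contTerm (σ : ℕ → Term) (k : ToPartrec.Cont) :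
    (contTerm k).subst σ = contTerm k := by
  induction k <;> simp_all [contTerm]

theorem subst_stateTerm (σ : ℕ → Term) (q : MachineState) :
    (stateTerm q).subst σ = stateTerm q := by
  cases q <;> simp [stateTerm]

/-- The state of the machine after `n` steps, if it has not stopped before. -/
def machineRun (q : MachineState) : ℕ → Option MachineState
  | 0 => some q
  | n + 1 => (machineRun q n).bind machineStep

theorem reaches_iff_machineRun {q q' : MachineState} :
    Reaches machineStep q q' ↔ ∃ n, machineRun q n = some q' := by
  constructor
  · intro h
    induction h with
    | refl => exact ⟨0, rfl⟩
    | tail _ h ih =>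
      obtain ⟨n, hn⟩ := ih
      exact ⟨n + 1, by rw [machineRun, hn]; exact h⟩
  · rintro ⟨n, hn⟩
    induction n generalizing q' with
    | zero => cases hn; exact .refl
    | succ n ih =>
      obtain ⟨q'', h₁, h₂⟩ := Option.bind_eq_some_iff.1 hn
      exact (ih h₁).tail h₂

theorem eval_machineStep_dom_iff (q : MachineState) :
    (eval machineStep q).Dom ↔ ∃ n, machineRun q n = none := by
  constructor
  · intro h
    obtain ⟨h₁, h₂⟩ := mem_eval.1 (Part.get_mem h)
    obtain ⟨n, hn⟩ := reaches_iff_machineRun.1 h₁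
    exact ⟨n + 1, by rw [machineRun, hn]; exact h₂⟩
  · rintro ⟨n, hn⟩
    induction n with
    | zero => cases hn
    | succ n ih =>
      cases hq : machineRun q n with
      | none => exact ih hq
      | some q' =>
        rw [machineRun, hq] at hn
        exact Part.dom_iff_mem.2 ⟨q', mem_eval.2 ⟨reaches_iff_machineRun.2 ⟨n, hq⟩, hn⟩⟩

theorem machineRun_eq_none_of_le {q : MachineState} {m n : ℕ} (hmn : m ≤ n)
    (h : machineRun q m = none) : machineRun q n = none := by
  induction n, hmn using Nat.le_induction with
  | base => exact h
  | succ n _ ih => rw [machineRun, ih]; rfl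

theorem machineRun_of_isRun {q : MachineState} {n : ℕ} {t : Term}
    (h : IsRun machineRules (stateTerm q) n t) :
    ∃ q', machineRun q n = some q' ∧ t = stateTerm q' := by
  induction n generalizing t with
  | zero => exact ⟨q, rfl, h⟩
  | succ n ih =>
    obtain ⟨t', h₁, h₂⟩ := h
    obtain ⟨q', hq', rfl⟩ := ih h₁
    obtain ⟨q'', hq'', rfl⟩ := machineStep_of_isStep h₂
    exact ⟨q'', by rw [machineRun, hq']; exact hq'', rfl⟩

/-- The prenex formula that is valid exactly if the evaluation of the code `c` at the list `v` does
not terminate. -/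
def nonhalting (c : ToPartrec.Code) (v : List ℕ) : Formula :=
  noTree machineRules 7 (stateTerm (.eval c .halt v))

theorem nonhalting_mem_logic_iff {V : Set ℝ} (hV : IsTruthValueSet V) (hc : V.Countable)
    (hinf : V.Infinite) (c : ToPartrec.Code) (v : List ℕ) :
    nonhalting c v ∈ logic.{u} V ↔ ¬ (c.eval v).Dom := by
  rw [← machine_halts_iff, eval_machineStep_dom_iff, nonhalting]
  generalize MachineState.eval c .halt v = q
  constructor
  · rintro h ⟨N, hN⟩
    refine noTree_notMem_logic_of_bounded_run hV hinf 7 (subst_stateTerm · q)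
      (N := N) (fun n t hn => ?_) h
    obtain ⟨q', hq', -⟩ := machineRun_of_isRun hn
    by_contra hlt
    rw [machineRun_eq_none_of_le (by omega) hN] at hq'
    cases hq'
  · intro h
    have h' : ∀ n, ∃ q', machineRun q n = some q' := fun n =>
      Option.ne_none_iff_exists'.1 fun hn => h ⟨n, hn⟩
    choose r hr using h'
    have h0 : r 0 = q := (Option.some.inj (hr 0)).symm
    have := noTree_mem_logic_of_infinite_run.{u} hV hc (by norm_num) machineRules_hasVarsBelow
      (t := fun n => stateTerm (r n)) fun n => isStep_of_machineStep <| by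
        have := hr (n + 1)
        rwa [machineRun, hr n] at this
    rwa [h0] at this

/-! ### Computability of the reduction -/

theorem code_app₁ (f : ℕ) (a : Term) :
    (app₁ f a).code = Nat.pair 1 (Nat.pair f (Nat.pair a.code 0 + 1)) := by
  simp [app₁, Term.code, List.ofFn_succ]

theorem code_app₂ (f : ℕ) (a b : Term) :
    (app₂ f a b).code =
      Nat.pair 1 (Nat.pair f (Nat.pair a.code (Nat.pair b.code 0 + 1) + 1)) := by
  simp [app₂, Term.code, List.ofFn_succ]

theorem code_app₃ (f : ℕ) (a b c : Term) :
    (app₃ f a b c).code = Nat.pair 1 (Nat.pair f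
      (Nat.pair a.code (Nat.pair b.code (Nat.pair c.code 0 + 1) + 1) + 1)) := by
  simp [app₃, Term.code, List.ofFn_succ]

theorem code_pred₂ (p : ℕ) (a b : Term) :
    (Formula.pred 2 p ![a, b]).code =
      Nat.pair 1 (Nat.pair p (Nat.pair a.code (Nat.pair b.code 0 + 1) + 1)) := by
  simp [Formula.code, List.ofFn_succ]

theorem primrec_code_natTerm : Primrec fun n => (natTerm n).code := by
  refine (Primrec.nat_rec₁ (f := fun _ a => Nat.pair 1 (Nat.pair 0 (Nat.pair a 0 + 1)))
    (natTerm 0).code ?_).of_eq fun n => ?_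
  · exact Primrec₂.natPair.comp (.const 1) (Primrec₂.natPair.comp (.const 0)
      (Primrec.succ.comp (Primrec₂.natPair.comp .snd (.const 0))))
  · induction n with
    | zero => rfl
    | succ n ih => simp only [natTerm, code_app₁] at ih ⊢; rw [← ih]

theorem primrec_code_exs {f : ℕ → Formula} (hf : Primrec fun e => (f e).code) (n : ℕ) :
    Primrec fun e => ((f e).exs n).code := by
  induction n with
  | zero => exact hf
  | succ n ih =>
    exact Primrec₂.natPair.comp (.const 6) (Primrec₂.natPair.comp (.const n) ih)

theorem primrec_code_noTree (R : List (Term × Term)) (m : ℕ) {f : ℕ → Term}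
    (hf : Primrec fun e => (f e).code) : Primrec fun e => (noTree R m (f e)).code := by
  refine primrec_code_exs ?_ m
  induction R with
  | nil =>
    have h : ∀ p, Primrec fun e => (Formula.pred 2 p ![rootTerm, f e]).code := fun p => by
      simp only [code_pred₂]
      exact Primrec₂.natPair.comp (.const 1) (Primrec₂.natPair.comp (.const p)
        (Primrec.succ.comp (Primrec₂.natPair.comp (.const _)
          (Primrec.succ.comp (Primrec₂.natPair.comp hf (.const 0))))))
    exact Primrec₂.natPair.comp (.const 4) (Primrec₂.natPair.comp (h 1) (h 0))
  | cons p R ih =>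
    exact Primrec₂.natPair.comp (.const 3) (Primrec₂.natPair.comp (.const _) ih)

theorem primrec_code_nonhalting (c : ToPartrec.Code) :
    Primrec fun n => (nonhalting c [n]).code := by
  refine primrec_code_noTree _ _ ?_
  simp only [stateTerm, listTerm, code_app₃, code_app₂]
  refine Primrec₂.natPair.comp (.const 1) (Primrec₂.natPair.comp (.const 1)
    (Primrec.succ.comp (Primrec₂.natPair.comp (.const _)
      (Primrec.succ.comp (Primrec₂.natPair.comp (.const _)
        (Primrec.succ.comp (Primrec₂.natPair.comp ?_ (.const 0))))))))
  exact Primrec₂.natPair.comp (.const 1) (Primrec₂.natPair.comp (.const 0)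
    (Primrec.succ.comp (Primrec₂.natPair.comp primrec_code_natTerm (.const _))))

/-- There is a code of `Turing.ToPartrec` whose domain is the halting problem. -/
theorem exists_universal_code :
    ∃ c : ToPartrec.Code, ∀ e : Nat.Partrec.Code,
      (c.eval [Encodable.encode e]).Dom ↔ (e.eval 0).Dom := by
  have h : Partrec fun n : ℕ => (Denumerable.ofNat Nat.Partrec.Code n).eval 0 :=
    Nat.Partrec.Code.eval_part.comp (Computable.ofNat _) (Computable.const 0)
  obtain ⟨c, hc⟩ := ToPartrec.Code.exists_code (Nat.Partrec'.part_iff₁.2 h)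
  refine ⟨c, fun e => ?_⟩
  have := hc ⟨[Encodable.encode e], rfl⟩
  simp only [List.Vector.head, Denumerable.ofNat_encode] at this
  rw [this]
  rfl

end GoedelLogic

theorem theorem6p2 (V : Set ℝ) (hV : GoedelLogic.IsTruthValueSet V)
    (hcount : V.Countable) (hinf : V.Infinite) :
    ¬ GoedelLogic.IsAxiomatizable (GoedelLogic.prenexFragment.{u} V) := by
  intro h
  obtain ⟨c, hc⟩ := GoedelLogic.exists_universal_code
  have hcomp : Computable fun e : Nat.Partrec.Code =>
      (GoedelLogic.nonhalting c [Encodable.encode e]).code :=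
    (GoedelLogic.primrec_code_nonhalting c).to_comp.comp Computable.encode
  have hre : REPred fun e : Nat.Partrec.Code => ∃ A ∈ GoedelLogic.prenexFragment.{u} V,
      A.code = (GoedelLogic.nonhalting c [Encodable.encode e]).code := by
    unfold GoedelLogic.IsAxiomatizable REPred at h
    exact h.comp hcomp
  refine ComputablePred.halting_problem_not_re 0 (hre.of_eq fun e => ?_)
  rw [← hc e, ← GoedelLogic.nonhalting_mem_logic_iff.{u} hV hcount hinf]
  constructor
  · rintro ⟨A, hA, hcode⟩
    rw [← GoedelLogic.Formula.code_injective hcode]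
    exact hA.2
  · exact fun hmem => ⟨_, ⟨GoedelLogic.noTree_isPrenex _ _ _, hmem⟩, rfl⟩
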